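/- Let $G$ be a finite group, let $G^+\le G$ be a subgroup of index $2$, let $k\ge 1$, and let $K_1,\dots,K_k$ be distinct conjugacy classes of $G$, each consisting of involutions (elements of order $2$) in $G\setminus G^+$. Then there is a map $\mathcal M$ on a compact connected orientable surface $S$ without boundary such that $\operatorname{Aut}\mathcal M$ acts transitively on the vertices of $\mathcal M$, and there is an isomorphism $\theta\colon G\to\operatorname{Aut}\mathcal M$ such that, for every $g\in G$, the automorphism $\theta(g)$ is a reflection of $\mathcal M$ if and only if $g\in K_1\cup\dots\cup K_k$. Here a map on $S$ is a connected graph embedded in $S$ (loops and multiple edges are allowed, and both ends of every edge are at vertices) whose complement is a union of open discs, the faces. It is described by its flags, the triangles of its barycentric subdivision, whose corners are a vertex, an edge midpoint and a face centre and are labelled $0,1,2$ respectively. For $i=0,1,2$ let $r_i$ be the permutation of the set $\Phi$ of flags that interchanges any two flags sharing the side opposite to the corners labelled $i$. Then $\operatorname{Aut}\mathcal M$ is the group of all permutations of $\Phi$ that commute with $r_0,r_1,r_2$; it acts on $S$ by carrying triangles to triangles, preserving barycentric coordinates. A reflection of $\mathcal M$ is an automorphism that fixes a point of $S$ and acts on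 a disc-shaped open neighbourhood of that point like the reflection $z\mapsto\overline z$ on the open unit disc. -/

import Mathlib

/-- A (connected) map on a surface, given by its flags. The flags are the triangles of the
barycentric subdivision of the map; every triangle has its corners labelled `0`, `1`, `2`: the
corner `0` is a vertex of the map, the corner `1` the midpoint of an edge, the corner `2` the centre
of a face. The permutation `r i` sends a flag to the other flag that contains the side opposite to
the corner `i` (i.e. that has the same components of every dimension `j ≠ i`), and fixes the flag if
that side lies on the boundary. Thus `r 0`, `r 1`, `r 2` give a transitive permutation
representation of `⟨R₀, R₁, R₂ ∣ R₀² = R₁² = R₂² = (R₀R₂)² = 1⟩`. -/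
structure SurfaceMap where
  /-- The flags. -/
  Flag : Type
  /-- The adjacency permutations of the flags. -/
  r : Fin 3 → Equiv.Perm Flag
  nonempty : Nonempty Flag
  r_sq : ∀ i, r i ^ 2 = 1
  r_zero_r_two_sq : (r 0 * r 2) ^ 2 = 1
  transitive : ∀ φ ψ : Flag, ∃ g ∈ Subgroup.closure (Set.range r), g φ = ψ

namespace SurfaceMap

variable (M : SurfaceMap)

/-- A disjoint union of triangles, one for each flag. A point of a triangle is given by its
barycentric coordinates. -/
abbrev Triangles : Type := Σ _ : M.Flag, stdSimplex ℝ (Fin 3)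

/-- The triangle of `φ` is glued to the triangle of `r i φ` along the side opposite to the
corner `i`, respecting the labels of the corners. -/
inductive Glue : M.Triangles → M.Triangles → Prop
  | side (i : Fin 3) (φ : M.Flag) (t : stdSimplex ℝ (Fin 3)) (h : t.1 i = 0) :
      Glue ⟨φ, t⟩ ⟨M.r i φ, t⟩

/-- The underlying surface of the map: the triangles glued along their sides. The embedded graph is
the image of the sides opposite to the corners `2`, and a face is the open star of the image of a
corner `2`. -/
def Surface : Type := Quot M.Glue

/-- The quotient topology. -/
instance : TopologicalSpace M.Surface := inferInstanceAs (TopologicalSpace (Quot M.Glue))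

/-- The point with barycentric coordinates `t` in the triangle of the flag `φ`. -/
def point (φ : M.Flag) (t : stdSimplex ℝ (Fin 3)) : M.Surface := Quot.mk _ ⟨φ, t⟩

/-- The vertex of the map which is incident with the flag `φ`, as a point of the surface. -/
def vertex (φ : M.Flag) : M.Surface :=
  M.point φ ⟨Pi.single 0 1, single_mem_stdSimplex ℝ 0⟩

/-- The automorphism group of the map: the permutations of the flags that preserve all
adjacencies, i.e. the centraliser of the monodromy group `⟨r 0, r 1, r 2⟩`. -/
def Aut : Subgroup (Equiv.Perm M.Flag) := Subgroup.centralizer (Set.range M.r)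

variable {M}

/-- The action of an automorphism on the surface: it carries each triangle to its image, preserving
barycentric coordinates. -/
def act (σ : M.Aut) : M.Surface → M.Surface :=
  Quot.map (fun p => ⟨σ.1 p.1, p.2⟩) (by
    rintro _ _ ⟨i, φ, t, h⟩
    have hc : M.r i (σ.1 φ) = σ.1 (M.r i φ) :=
      DFunLike.congr_fun (Subgroup.mem_centralizer_iff.1 σ.2 (M.r i) ⟨i, rfl⟩) φ
    have hg := Glue.side i (σ.1 φ) t h
    rw [hc] at hg
    exact hg)

variable (M)

/-- `Aut M` is transitive on the vertices of the map. -/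
def VertexTransitive : Prop := ∀ φ ψ : M.Flag, ∃ σ : M.Aut, act σ (M.vertex φ) = M.vertex ψ

/-- The surface is orientable: the triangles of its triangulation by flags can be oriented
coherently. The order `0, 1, 2` of its corners orients every triangle, and the gluing preserves the
labels, so that a choice of orientations `± (0, 1, 2)` is coherent if and only if any two different
triangles with a common side carry opposite signs. -/
def Orientable : Prop :=
  ∃ o : M.Flag → ℤˣ, ∀ (i : Fin 3) (φ : M.Flag), M.r i φ ≠ φ → o (M.r i φ) = - o φ

/-- The map has no free edges. On a surface without boundary a flag with `r 0 φ = r 2 φ` would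
belong to an edge with only one end at a vertex, the other end being a free point of the surface. -/
def NoFreeEdges : Prop := ∀ φ : M.Flag, M.r 0 φ ≠ M.r 2 φ

variable {M}

/-- The automorphism is a reflection: it fixes a point of the surface and acts on a disc-shaped open
neighbourhood of that point like the reflection `z ↦ conj z` on the open unit disc. -/
def IsReflection (σ : M.Aut) : Prop :=
  ∃ (x : M.Surface) (e : OpenPartialHomeomorph M.Surface ℂ),
    act σ x = x ∧ x ∈ e.source ∧ e.target = Metric.ball 0 1 ∧
      ∀ y ∈ e.source, act σ y ∈ e.source ∧ e (act σ y) = (starRingEnd ℂ) (e y)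

end SurfaceMap

/-- A compact connected surface without boundary: a compact connected Hausdorff space in which every
point has an open neighbourhood homeomorphic to an open subset of the plane. -/
structure IsClosedSurface (X : Type*) [TopologicalSpace X] : Prop where
  compact : CompactSpace X
  connected : ConnectedSpace X
  hausdorff : T2Space X
  locally_plane : ∀ x : X, ∃ e : OpenPartialHomeomorph X ℂ, x ∈ e.source

/-! The map is a Cayley map with vertex set `G`. A flag is a triple of a vertex, a dart and a side
`±1`; crossing a dart `d` multiplies the vertex on the right by `label d`, and the darts at every
vertex are arranged in one cyclic order, read forwards or backwards according to the sign of the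
vertex (`+1` on `Gplus`, `-1` off it). The product of that sign and the side is an orientation
reversed by every `r i`. Left multiplication by `G` commutes with the `r i` and is transitive on
vertices.

Combinatorially, an automorphism is a reflection exactly when it sends some flag to an adjacent one
(`isReflection_iff`). A left multiplication preserves dart and side, whereas `r 1` and `r 2` change
the side, so only `r 0` can be matched: the reflections are the conjugates of the labels of sign
`-1` on darts with `rev d = d` (`isReflection_leftMul_iff`). Such darts are given labels in the
union `T` of the classes, every element of `T` occurring. Paired darts labelled by the other
generators make the graph connected without adding reflections.

No further automorphism may exist. Automorphisms act freely on flags (`aut_ext`), so it suffices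
that a marked flag can only go to its translates. Five extra darts, carrying two loops of which just
one bounds a monogon, ensure this (`exists_rigid_cayleySystem`).

The topology rests on `exists_star`: the open star of any corner is laid out in the plane in equal
sectors, and the resulting map extends continuously to the compact surface. This yields charts,
Hausdorffness and the local form of a reflection. -/

/-! ### Disc charts obtained from maps to a spindle. -/

theorem exists_openPartialHomeomorph_ball {X : Type*} [TopologicalSpace X] [CompactSpace X]
    {F : X → ℂ × ℝ} (hF : Continuous F) (hinj : ∀ x y, 0 < (F x).2 → F x = F y → x = y)
    (hnorm : ∀ x, 0 < (F x).2 → ‖(F x).1‖ = (F x).2 * (1 - (F x).2))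
    (hsurj : ∀ w : ℂ, ‖w‖ < 1 → ∃ x, F x = ((1 - ‖w‖ : ℝ) * w, 1 - ‖w‖)) :
    ∃ e : OpenPartialHomeomorph X ℂ, e.source = {x | 0 < (F x).2} ∧
      e.target = Metric.ball 0 1 ∧ ∀ x, e x = (F x).1 / (F x).2 := by
  classical
  have hX : Nonempty X := let ⟨x, _⟩ := hsurj 0 (by simp); ⟨x⟩
  choose! s hs using hsurj
  have hball : ∀ w : ℂ, w ∈ Metric.ball (0 : ℂ) 1 ↔ ‖w‖ < 1 := fun w => by simp
  have hquot : ∀ x, 0 < (F x).2 → ‖(F x).1 / ((F x).2 : ℂ)‖ = 1 - (F x).2 := by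
    intro x hx
    rw [norm_div, hnorm x hx, Complex.norm_real, Real.norm_of_nonneg hx.le]
    field_simp
  refine ⟨{ toFun := fun x => (F x).1 / (F x).2
            invFun := s
            source := {x | 0 < (F x).2}
            target := Metric.ball 0 1
            map_source' := ?_
            map_target' := ?_
            left_inv' := ?_
            right_inv' := ?_
            open_source := isOpen_lt continuous_const (continuous_snd.comp hF)
            open_target := Metric.isOpen_ball
            continuousOn_toFun := ?_
            continuousOn_invFun := ?_ }, rfl, rfl, fun _ => rfl⟩
  · intro x hx
    rw [hball, hquot x hx]
    have : 0 < (F x).2 := hx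
    linarith
  · intro w hw
    rw [hball] at hw
    simp only [Set.mem_ofPred_eq, hs w hw]
    linarith
  · intro x hx
    have hx' : 0 < (F x).2 := hx
    have h1 := hquot x hx
    have h2 := hs ((F x).1 / (F x).2) (by rw [h1]; linarith)
    refine (hinj _ _ hx ?_).symm
    rw [h2, h1]
    have : ((F x).2 : ℂ) ≠ 0 := by exact_mod_cast hx'.ne'
    ext1
    · simp only [sub_sub_cancel]
      field_simp
    · simp
  · intro w hw
    rw [hball] at hw
    have : ((1 - ‖w‖ : ℝ) : ℂ) ≠ 0 := by
      have : 1 - ‖w‖ ≠ 0 := by linarith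
      exact_mod_cast this
    simp only [hs w hw]
    field_simp
  · refine ContinuousOn.div (by fun_prop) (by fun_prop) ?_
    intro x hx
    have hx' : 0 < (F x).2 := hx
    exact_mod_cast hx'.ne'
  · have hc : Continuous fun w : ℂ => (((1 - ‖w‖ : ℝ) * w, 1 - ‖w‖) : ℂ × ℝ) := by fun_prop
    intro w hw
    refine ContinuousAt.continuousWithinAt ?_
    rw [hball] at hw
    intro V hV
    obtain ⟨W, hWV, hW, hwW⟩ := mem_nhds_iff.1 hV
    -- Continuity of the inverse comes from compactness: `F` is a closed map, and injectivity at
    -- positive height keeps the point in question out of the image of `Wᶜ`.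
    have hcl : IsClosed (F '' Wᶜ) := (hW.isClosed_compl.isCompact.image hF).isClosed
    have hmem : (((1 - ‖w‖ : ℝ) * w, 1 - ‖w‖) : ℂ × ℝ) ∈ (F '' Wᶜ)ᶜ := by
      rintro ⟨y, hy, hyw⟩
      rw [← hs w hw] at hyw
      have := hinj (s w) y (by rw [hs w hw]; simpa using hw) hyw.symm
      exact hy (this ▸ hwW)
    have h1 := hc.continuousAt.preimage_mem_nhds (hcl.isOpen_compl.mem_nhds hmem)
    have h2 : Metric.ball (0 : ℂ) 1 ∈ nhds w := Metric.isOpen_ball.mem_nhds (by rwa [hball])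
    rw [Filter.mem_map]
    filter_upwards [h1, h2] with v hv hv1
    rw [hball] at hv1
    refine hWV ?_
    by_contra hcon
    exact hv ⟨s v, hcon, hs v hv1⟩

theorem Fin.eq_or_eq_or_eq_of_ne {i j k : Fin 3} (hij : i ≠ j) (hik : i ≠ k) (hjk : j ≠ k)
    (l : Fin 3) : l = i ∨ l = j ∨ l = k := by
  omega

theorem Fin.sum_three_of_ne {i j k : Fin 3} (hij : i ≠ j) (hik : i ≠ k) (hjk : j ≠ k)
    (f : Fin 3 → ℝ) : ∑ l, f l = f i + f j + f k := by
  have : (Finset.univ : Finset (Fin 3)) = {i, j, k} := by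
    ext l
    simpa using Fin.eq_or_eq_or_eq_of_ne hij hik hjk l
  rw [this, Finset.sum_insert (by simp [hij, hik]), Finset.sum_insert (by simp [hjk]),
    Finset.sum_singleton, add_assoc]

/-! ### Flags, the free action of automorphisms, and the cycle of flags around a corner. -/

namespace SurfaceMap

section Flags

variable (M : SurfaceMap)

theorem r_r (i : Fin 3) (φ : M.Flag) : M.r i (M.r i φ) = φ := by
  have := DFunLike.congr_fun (M.r_sq i) φ
  simpa [sq] using this

theorem point_r {i : Fin 3} (φ : M.Flag) {t : stdSimplex ℝ (Fin 3)} (h : t.1 i = 0) :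
    M.point (M.r i φ) t = M.point φ t :=
  (Quot.sound (Glue.side i φ t h)).symm

variable {M}

theorem aut_r (σ : M.Aut) (i : Fin 3) (φ : M.Flag) : σ.1 (M.r i φ) = M.r i (σ.1 φ) :=
  (DFunLike.congr_fun (Subgroup.mem_centralizer_iff.1 σ.2 (M.r i) ⟨i, rfl⟩) φ).symm

theorem act_point (σ : M.Aut) (φ : M.Flag) (t : stdSimplex ℝ (Fin 3)) :
    act σ (M.point φ t) = M.point (σ.1 φ) t := rfl

theorem exists_point (x : M.Surface) : ∃ φ t, x = M.point φ t := by
  obtain ⟨⟨φ, t⟩, rfl⟩ := Quot.exists_rep x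
  exact ⟨φ, t, rfl⟩

/-- Automorphisms centralise a transitive group, hence act freely on the flags. -/
theorem aut_ext {σ τ : M.Aut} {φ : M.Flag} (h : σ.1 φ = τ.1 φ) : σ = τ := by
  refine Subtype.ext (Equiv.ext fun ψ => ?_)
  obtain ⟨g, hg, rfl⟩ := M.transitive φ ψ
  have hcomm : ∀ υ : M.Aut, υ.1 (g φ) = g (υ.1 φ) := fun υ =>
    (DFunLike.congr_fun (Subgroup.mem_centralizer_iff.1
      ((Subgroup.centralizer_closure (Set.range M.r)).symm ▸ υ.2) g hg) φ).symm
  rw [hcomm, hcomm, h]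

end Flags

section Walk

variable {M : SurfaceMap} (i j : Fin 3) (φ : M.Flag)

/-- The flags around a corner, obtained from `φ` by applying `r i` and `r j` alternately. -/
def walk (n : ℤ) : M.Flag :=
  if Even n then ((M.r j * M.r i) ^ (n / 2)) φ else M.r i (((M.r j * M.r i) ^ (n / 2)) φ)

theorem walk_even (a : ℤ) : walk i j φ (2 * a) = ((M.r j * M.r i) ^ a) φ := by
  simp [walk]

theorem walk_odd (a : ℤ) : walk i j φ (2 * a + 1) = M.r i (((M.r j * M.r i) ^ a) φ) := by
  have h1 : ¬ Even (2 * a + 1) := by simp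
  have h2 : (2 * a + 1) / 2 = a := by omega
  rw [walk, if_neg h1, h2]

theorem walk_zero : walk i j φ 0 = φ := by simpa using walk_even i j φ 0

theorem r_fst_walk_even (a : ℤ) : M.r i (walk i j φ (2 * a)) = walk i j φ (2 * a + 1) := by
  rw [walk_even, walk_odd]

theorem r_fst_walk_odd (a : ℤ) : M.r i (walk i j φ (2 * a + 1)) = walk i j φ (2 * a) := by
  rw [← r_fst_walk_even, r_r]

theorem r_snd_walk_odd (a : ℤ) : M.r j (walk i j φ (2 * a + 1)) = walk i j φ (2 * (a + 1)) := by
  rw [walk_even, walk_odd, add_comm a 1, zpow_one_add]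
  rfl

theorem r_snd_walk_even (a : ℤ) : M.r j (walk i j φ (2 * (a + 1))) = walk i j φ (2 * a + 1) := by
  rw [← r_snd_walk_odd, r_r]

theorem exists_walk_eq_r_fst (n : ℤ) : ∃ n', walk i j φ n' = M.r i (walk i j φ n) := by
  obtain ⟨a, rfl | rfl⟩ := Int.even_or_odd' n
  · exact ⟨_, (r_fst_walk_even i j φ a).symm⟩
  · exact ⟨_, (r_fst_walk_odd i j φ a).symm⟩

theorem exists_walk_eq_r_snd (n : ℤ) : ∃ n', walk i j φ n' = M.r j (walk i j φ n) := by
  obtain ⟨a, rfl | rfl⟩ := Int.even_or_odd' n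
  · exact ⟨_, by rw [← r_snd_walk_even i j φ (a - 1), sub_add_cancel]⟩
  · exact ⟨_, (r_snd_walk_odd i j φ a).symm⟩

/-- An automorphism commutes with both steps of the walk; once it swaps the flags numbered `0` and
`1`, it must reverse the whole walk about the side between them. -/
theorem aut_walk {σ : M.Aut} (h : σ.1 φ = M.r i φ) (n : ℤ) :
    σ.1 (walk i j φ n) = walk i j φ (1 - n) := by
  have hzero : σ.1 (walk i j φ (2 * 0)) = walk i j φ (2 * 0 + 1) := by
    rw [← r_fst_walk_even, mul_zero, walk_zero, h]
  have key : ∀ a : ℤ, σ.1 (walk i j φ (2 * a)) = walk i j φ (2 * (-a) + 1) := by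
    intro a
    induction a using Int.induction_on with
    | zero => simpa using hzero
    | succ a ih =>
      rw [← r_snd_walk_odd, ← r_fst_walk_even, aut_r, aut_r, ih, r_fst_walk_odd]
      have : (-(a : ℤ)) = (-(a + 1 : ℤ)) + 1 := by ring
      rw [this, r_snd_walk_even]
    | pred a ih =>
      have h1 : (-(a : ℤ)) = (-(a : ℤ) - 1) + 1 := by ring
      rw [h1, ← r_snd_walk_odd, ← r_fst_walk_even, aut_r, aut_r] at ih
      have h2 := congrArg (fun ψ => M.r i (M.r j ψ)) ih
      simp only [r_r] at h2
      rw [h2, r_snd_walk_odd, r_fst_walk_even]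
      congr 1
      ring
  obtain ⟨a, rfl | rfl⟩ := Int.even_or_odd' n
  · rw [key]; congr 1; ring
  · rw [← r_fst_walk_even, aut_r, key, r_fst_walk_odd]; congr 1; ring

theorem point_walk {t : stdSimplex ℝ (Fin 3)} (hi : t.1 i = 0) (hj : t.1 j = 0) (n : ℤ) :
    M.point (walk i j φ n) t = M.point φ t := by
  have key : ∀ a : ℤ, M.point (walk i j φ (2 * a)) t = M.point φ t := by
    have step : ∀ a : ℤ, M.point (walk i j φ (2 * (a + 1))) t = M.point (walk i j φ (2 * a)) t :=
      fun a => by rw [← r_snd_walk_odd, point_r _ _ hj, ← r_fst_walk_even, point_r _ _ hi]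
    intro a
    induction a using Int.induction_on with
    | zero => rw [mul_zero, walk_zero]
    | succ a ih => rw [step, ih]
    | pred a ih => rw [← step, sub_add_cancel, ih]
  obtain ⟨a, rfl | rfl⟩ := Int.even_or_odd' n
  · exact key a
  · rw [← r_fst_walk_even, point_r _ _ hi, key]

/-- The orientation alternates along the walk, so flags of even and odd number never coincide. The
period is therefore twice that of `r j * r i` at `φ`, and the `2m` flags can share the full angle as
sectors of angle `π / m`. -/
theorem exists_period [Finite M.Flag] {o : M.Flag → ℤˣ} (ho : ∀ i φ, o (M.r i φ) = - o φ) :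
    ∃ m : ℕ, 0 < m ∧ ∀ n n' : ℤ, walk i j φ n = walk i j φ n' ↔ ∃ l : ℤ, n = n' + 2 * m * l := by
  set ρ := M.r j * M.r i with hρ
  have hpos : 0 < Function.minimalPeriod (ρ • ·) φ := by
    apply Function.minimalPeriod_pos_of_mem_periodicPts
    exact (MulAction.injective ρ).mem_periodicPts φ
  have heven : ∀ a : ℤ, o ((ρ ^ a) φ) = o φ := by
    intro a
    have step : ∀ ψ, o (ρ ψ) = o ψ := fun ψ => by
      rw [hρ, Equiv.Perm.mul_apply, ho, ho, neg_neg]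
    induction a using Int.induction_on with
    | zero => simp
    | succ a ih => rw [add_comm, zpow_one_add, Equiv.Perm.mul_apply, step, ih]
    | pred a ih => rw [← step, ← Equiv.Perm.mul_apply, ← zpow_one_add, add_sub_cancel, ih]
  have hdvd : ∀ a b : ℤ, (ρ ^ a) φ = (ρ ^ b) φ ↔
      ∃ l : ℤ, a = b + Function.minimalPeriod (ρ • ·) φ * l := by
    intro a b
    have h1 := MulAction.zpow_smul_eq_iff_minimalPeriod_dvd (a := ρ) (b := φ) (n := a - b)
    have h2 : (ρ ^ a) φ = (ρ ^ b) φ ↔ ρ ^ (a - b) • φ = φ := by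
      rw [sub_eq_neg_add, zpow_add, mul_smul, zpow_neg, inv_smul_eq_iff]
      rfl
    rw [h2, h1]
    exact ⟨fun ⟨l, hl⟩ => ⟨l, by linarith⟩, fun ⟨l, hl⟩ => ⟨l, by linarith⟩⟩
  have hne : ∀ u : ℤˣ, u ≠ -u := by decide
  refine ⟨_, hpos, fun n n' => ?_⟩
  generalize Function.minimalPeriod (ρ • ·) φ = m at hdvd
  obtain ⟨a, rfl | rfl⟩ := Int.even_or_odd' n <;> obtain ⟨b, rfl | rfl⟩ := Int.even_or_odd' n'
  · rw [walk_even, walk_even, hdvd]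
    refine exists_congr fun l => ?_
    constructor <;> intro h <;> linarith
  · rw [walk_even, walk_odd]
    constructor
    · intro h
      have := congrArg o h
      rw [ho, heven, heven] at this
      exact absurd this (hne _)
    · rintro ⟨l, hl⟩
      have : 2 * a = 2 * (b + m * l) + 1 := by linarith
      omega
  · rw [walk_even, walk_odd]
    constructor
    · intro h
      have := congrArg o h
      rw [ho, heven, heven] at this
      exact absurd this.symm (hne _)
    · rintro ⟨l, hl⟩
      have : 2 * a + 1 = 2 * (b + m * l) := by linarith
      omega
  · rw [walk_odd, walk_odd, (M.r i).apply_eq_iff_eq, hdvd]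
    refine exists_congr fun l => ?_
    constructor <;> intro h <;> linarith

end Walk

end SurfaceMap

/-! ### Plane sectors and the star of a corner. -/

namespace SurfaceMap

section Sector

variable (i j : Fin 3)

/-- The ratio in which a point of a triangle divides the angle at the third corner, as seen
from the side opposite to the corner `i`. -/
noncomputable def angleRatio (t : stdSimplex ℝ (Fin 3)) : ℝ := t.1 i / (t.1 i + t.1 j)

/-- The angle at which a point of the `n`-th triangle around a corner is drawn, if every triangle
there gets the angle `1`. -/
noncomputable def sectorAngle (n : ℤ) (t : stdSimplex ℝ (Fin 3)) : ℝ :=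
  if Even n then n - angleRatio i j t else n - 1 + angleRatio i j t

/-- The point of the `n`-th sector of angle `π / m` of the plane that corresponds to a point of a
triangle. -/
noncomputable def sectorPoint (m : ℕ) (n : ℤ) (t : stdSimplex ℝ (Fin 3)) : ℂ :=
  (t.1 i + t.1 j : ℝ) * Complex.exp ((sectorAngle i j n t * (Real.pi / m) : ℝ) * Complex.I)

variable {i j}

theorem angleRatio_nonneg (t : stdSimplex ℝ (Fin 3)) : 0 ≤ angleRatio i j t :=
  div_nonneg (t.2.1 i) (add_nonneg (t.2.1 i) (t.2.1 j))

theorem angleRatio_le_one (t : stdSimplex ℝ (Fin 3)) : angleRatio i j t ≤ 1 :=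
  div_le_one_of_le₀ (le_add_of_nonneg_right (t.2.1 j)) (add_nonneg (t.2.1 i) (t.2.1 j))

theorem sectorAngle_even (a : ℤ) (t : stdSimplex ℝ (Fin 3)) :
    sectorAngle i j (2 * a) t = 2 * a - angleRatio i j t := by
  simp [sectorAngle]

theorem sectorAngle_odd (a : ℤ) (t : stdSimplex ℝ (Fin 3)) :
    sectorAngle i j (2 * a + 1) t = 2 * a + angleRatio i j t := by
  have h1 : ¬ Even (2 * a + 1) := by simp
  rw [sectorAngle, if_neg h1]
  push_cast
  ring

theorem sectorAngle_add (n l : ℤ) (t : stdSimplex ℝ (Fin 3)) :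
    sectorAngle i j (n + 2 * l) t = sectorAngle i j n t + 2 * l := by
  obtain ⟨a, rfl | rfl⟩ := Int.even_or_odd' n
  · rw [← mul_add, sectorAngle_even, sectorAngle_even]; push_cast; ring
  · have : 2 * a + 1 + 2 * l = 2 * (a + l) + 1 := by ring
    rw [this, sectorAngle_odd, sectorAngle_odd]; push_cast; ring

/-- Triangle `n` occupies the angles from `n - 1` to `n`, so the side shared by triangles `0` and
`1` lies on the positive real axis and complex conjugation exchanges `n` with `1 - n`. -/
theorem sectorAngle_one_sub (n : ℤ) (t : stdSimplex ℝ (Fin 3)) :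
    sectorAngle i j (1 - n) t = - sectorAngle i j n t := by
  obtain ⟨a, rfl | rfl⟩ := Int.even_or_odd' n
  · have : 1 - 2 * a = 2 * (-a) + 1 := by ring
    rw [this, sectorAngle_odd, sectorAngle_even]; push_cast; ring
  · have : 1 - (2 * a + 1) = 2 * (-a) := by ring
    rw [this, sectorAngle_odd, sectorAngle_even]; push_cast; ring

theorem sectorPoint_one_sub (m : ℕ) (n : ℤ) (t : stdSimplex ℝ (Fin 3)) :
    sectorPoint i j m (1 - n) t = (starRingEnd ℂ) (sectorPoint i j m n t) := by
  rw [sectorPoint, sectorPoint, sectorAngle_one_sub, map_mul, ← Complex.exp_conj, map_mul,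
    Complex.conj_ofReal, Complex.conj_ofReal, Complex.conj_I]
  congr 2
  push_cast
  ring

theorem norm_sectorPoint (m : ℕ) (n : ℤ) (t : stdSimplex ℝ (Fin 3)) :
    ‖sectorPoint i j m n t‖ = t.1 i + t.1 j := by
  rw [sectorPoint, norm_mul, Complex.norm_exp_ofReal_mul_I, mul_one, Complex.norm_real,
    Real.norm_of_nonneg (add_nonneg (t.2.1 i) (t.2.1 j))]

theorem sectorPoint_eq_of_zero (m : ℕ) (n n' : ℤ) {t : stdSimplex ℝ (Fin 3)}
    (h : t.1 i + t.1 j = 0) : sectorPoint i j m n t = sectorPoint i j m n' t := by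
  simp [sectorPoint, h]

theorem sectorPoint_fst_side (m : ℕ) (a : ℤ) {t : stdSimplex ℝ (Fin 3)} (h : t.1 i = 0) :
    sectorPoint i j m (2 * a + 1) t = sectorPoint i j m (2 * a) t := by
  simp [sectorPoint, sectorAngle_odd, sectorAngle_even, angleRatio, h]

theorem sectorPoint_snd_side (m : ℕ) (a : ℤ) {t : stdSimplex ℝ (Fin 3)} (h : t.1 j = 0) :
    sectorPoint i j m (2 * a + 1) t = sectorPoint i j m (2 * (a + 1)) t := by
  by_cases hi : t.1 i = 0
  · exact sectorPoint_eq_of_zero m _ _ (by rw [hi, h, add_zero])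
  · have : angleRatio i j t = 1 := by rw [angleRatio, h, add_zero, div_self hi]
    rw [sectorPoint, sectorPoint, sectorAngle_odd, sectorAngle_even, this]
    congr 4
    push_cast
    ring

theorem exp_angle_eq_iff {m : ℕ} (hm : 0 < m) (x y : ℝ) :
    Complex.exp ((x * (Real.pi / m) : ℝ) * Complex.I) =
      Complex.exp ((y * (Real.pi / m) : ℝ) * Complex.I) ↔ ∃ l : ℤ, x = y + 2 * m * l := by
  have hpi := Real.pi_ne_zero
  have hm' : (m : ℝ) ≠ 0 := by positivity
  rw [Complex.exp_eq_exp_iff_exists_int]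
  refine exists_congr fun l => ?_
  have h1 : ((y * (Real.pi / m) : ℝ) : ℂ) * Complex.I + l * (2 * Real.pi * Complex.I) =
      ((y * (Real.pi / m) + l * (2 * Real.pi) : ℝ) : ℂ) * Complex.I := by
    push_cast; ring
  rw [h1, mul_left_inj' Complex.I_ne_zero, Complex.ofReal_inj]
  field_simp

theorem sectorPoint_periodic {m : ℕ} (hm : 0 < m) (n l : ℤ) (t : stdSimplex ℝ (Fin 3)) :
    sectorPoint i j m (n + 2 * m * l) t = sectorPoint i j m n t := by
  rw [sectorPoint, sectorPoint]
  congr 1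
  rw [exp_angle_eq_iff hm, mul_assoc, sectorAngle_add]
  exact ⟨l, by push_cast; ring⟩

theorem continuous_sectorPoint (m : ℕ) (n : ℤ) : Continuous (sectorPoint i j m n) := by
  have hi : ∀ l : Fin 3, Continuous fun t : stdSimplex ℝ (Fin 3) => t.1 l := fun l =>
    (continuous_apply l).comp continuous_subtype_val
  rw [continuous_iff_continuousAt]
  intro t
  -- At the apex the angle has no limit, but the modulus tends to `0`.
  by_cases h : t.1 i + t.1 j = 0
  · have h0 : sectorPoint i j m n t = 0 := by simp [sectorPoint, h]
    rw [ContinuousAt, h0, tendsto_zero_iff_norm_tendsto_zero]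
    simp only [norm_sectorPoint]
    have : Filter.Tendsto (fun t : stdSimplex ℝ (Fin 3) => t.1 i + t.1 j) (nhds t)
        (nhds (t.1 i + t.1 j)) := ((hi i).add (hi j)).tendsto t
    rwa [h] at this
  · have h1 : ContinuousAt (angleRatio i j) t :=
      (hi i).continuousAt.div ((hi i).add (hi j)).continuousAt h
    have h2 : ContinuousAt (sectorAngle i j n) t := by
      unfold sectorAngle
      split_ifs <;> fun_prop
    have h3 := (hi i).continuousAt (x := t)
    have h4 := (hi j).continuousAt (x := t)
    exact (Complex.continuous_ofReal.continuousAt.comp (h3.add h4)).mul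
      (((Complex.continuous_ofReal.continuousAt.comp (h2.mul_const _)).mul_const _).cexp)

variable {k : Fin 3}

theorem simplex_sum (hij : i ≠ j) (hik : i ≠ k) (hjk : j ≠ k) (t : stdSimplex ℝ (Fin 3)) :
    t.1 i + t.1 j + t.1 k = 1 := by
  rw [← Fin.sum_three_of_ne hij hik hjk, t.2.2]

theorem simplex_ext (hij : i ≠ j) (hik : i ≠ k) (hjk : j ≠ k) {t t' : stdSimplex ℝ (Fin 3)}
    (hi : t.1 i = t'.1 i) (hk : t.1 k = t'.1 k) : t = t' := by
  refine Subtype.ext (funext fun l => ?_)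
  have h1 := simplex_sum hij hik hjk t
  have h2 := simplex_sum hij hik hjk t'
  obtain rfl | rfl | rfl := Fin.eq_or_eq_or_eq_of_ne hij hik hjk l
  · exact hi
  · linarith
  · exact hk

theorem simplex_ext_of_angleRatio (hij : i ≠ j) (hik : i ≠ k) (hjk : j ≠ k)
    {t t' : stdSimplex ℝ (Fin 3)} (hk : t.1 k = t'.1 k) (hne : t.1 i + t.1 j ≠ 0)
    (h : angleRatio i j t = angleRatio i j t') : t = t' := by
  refine simplex_ext hij hik hjk ?_ hk
  have h1 := simplex_sum hij hik hjk t
  have h2 := simplex_sum hij hik hjk t'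
  have h3 : t'.1 i + t'.1 j = t.1 i + t.1 j := by linarith
  rw [angleRatio, angleRatio, h3] at h
  field_simp at h
  exact h

theorem fst_eq_zero_of_angleRatio {t : stdSimplex ℝ (Fin 3)} (hne : t.1 i + t.1 j ≠ 0)
    (h : angleRatio i j t = 0) : t.1 i = 0 :=
  (div_eq_zero_iff.1 h).resolve_right hne

theorem snd_eq_zero_of_angleRatio {t : stdSimplex ℝ (Fin 3)} (hne : t.1 i + t.1 j ≠ 0)
    (h : angleRatio i j t = 1) : t.1 j = 0 := by
  rw [angleRatio, div_eq_one_iff_eq hne] at h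
  linarith

theorem exists_simplex (hij : i ≠ j) (hik : i ≠ k) (hjk : j ≠ k) {u v w : ℝ} (hu : 0 ≤ u)
    (hv : 0 ≤ v) (hw : 0 ≤ w) (h : u + v + w = 1) :
    ∃ t : stdSimplex ℝ (Fin 3), t.1 i = u ∧ t.1 j = v ∧ t.1 k = w := by
  refine ⟨⟨fun l => if l = i then u else if l = j then v else w, fun l => ?_, ?_⟩, ?_, ?_, ?_⟩
  · dsimp only
    split_ifs <;> assumption
  · rw [Fin.sum_three_of_ne hij hik hjk]
    simpa [hij.symm, hik.symm, hjk.symm] using h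
  · simp
  · simp [hij.symm]
  · simp [hik.symm, hjk.symm]

theorem exists_sectorPoint_eq (hij : i ≠ j) (hik : i ≠ k) (hjk : j ≠ k) {m : ℕ} (hm : 0 < m)
    {w : ℂ} (hw : ‖w‖ < 1) :
    ∃ (n : ℤ) (t : stdSimplex ℝ (Fin 3)), sectorPoint i j m n t = w ∧ t.1 k = 1 - ‖w‖ := by
  obtain rfl | hw0 := eq_or_ne w 0
  · obtain ⟨t, hi, hj, hk⟩ := exists_simplex hij hik hjk le_rfl le_rfl zero_le_one (by norm_num)
    exact ⟨0, t, by simp [sectorPoint, hi, hj], by simp [hk]⟩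
  have hpos : 0 < ‖w‖ := norm_pos_iff.2 hw0
  -- The argument in units of `π / m`; the sector containing it has number `⌈θ⌉`.
  set θ : ℝ := w.arg * m / Real.pi with hθ
  have key : ∀ (n : ℤ) (c : ℝ), 0 ≤ c → c ≤ 1 → (∀ t, angleRatio i j t = c →
      sectorAngle i j n t = θ) →
      ∃ (n : ℤ) (t : stdSimplex ℝ (Fin 3)), sectorPoint i j m n t = w ∧ t.1 k = 1 - ‖w‖ := by
    intro n c hc0 hc1 hc
    obtain ⟨t, hi, hj, hk⟩ := exists_simplex hij hik hjk (u := ‖w‖ * c) (v := ‖w‖ * (1 - c))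
      (w := 1 - ‖w‖) (by positivity) (mul_nonneg hpos.le (by linarith)) (by linarith) (by ring)
    refine ⟨n, t, ?_, hk⟩
    have hsum : t.1 i + t.1 j = ‖w‖ := by rw [hi, hj]; ring
    have hr : angleRatio i j t = c := by
      rw [angleRatio, hsum, hi]
      field_simp
    have hm' : (m : ℝ) ≠ 0 := by positivity
    have hpi := Real.pi_ne_zero
    have : w.arg * m / Real.pi * (Real.pi / m) = w.arg := by field_simp
    rw [sectorPoint, hc t hr, hsum, hθ, this]
    exact Complex.norm_mul_exp_arg_mul_I w
  have h1 := Int.le_ceil θ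
  have h2 := Int.ceil_lt_add_one θ
  obtain ⟨a, ha | ha⟩ := Int.even_or_odd' ⌈θ⌉
  · rw [ha] at h1 h2
    push_cast at h1 h2
    exact key (2 * a) (2 * a - θ) (by linarith) (by linarith) fun t ht => by
      rw [sectorAngle_even, ht]; ring
  · rw [ha] at h1 h2
    push_cast at h1 h2
    exact key (2 * a + 1) (θ - 2 * a) (by linarith) (by linarith) fun t ht => by
      rw [sectorAngle_odd, ht]; ring

variable {M : SurfaceMap}

/-- Angle intervals of distinct sectors meet at most in an endpoint. Equal angles thus mean the same
triangle or the common side of two consecutive ones, where the points are glued. -/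
theorem point_walk_eq_of_sectorAngle_eq (hij : i ≠ j) (hik : i ≠ k) (hjk : j ≠ k) (φ : M.Flag)
    {n n' : ℤ} {t t' : stdSimplex ℝ (Fin 3)} (hk : t.1 k = t'.1 k) (hne : t.1 i + t.1 j ≠ 0)
    (h : sectorAngle i j n t = sectorAngle i j n' t') :
    M.point (walk i j φ n) t = M.point (walk i j φ n') t' := by
  have h1 := simplex_sum hij hik hjk t
  have h2 := simplex_sum hij hik hjk t'
  have hne' : t'.1 i + t'.1 j ≠ 0 := by
    intro h
    exact hne (by linarith)
  have c0 := angleRatio_nonneg (i := i) (j := j) t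
  have c1 := angleRatio_le_one (i := i) (j := j) t
  have d0 := angleRatio_nonneg (i := i) (j := j) t'
  have d1 := angleRatio_le_one (i := i) (j := j) t'
  have mixed : ∀ (a b : ℤ) (t t' : stdSimplex ℝ (Fin 3)), t.1 k = t'.1 k →
      t.1 i + t.1 j ≠ 0 → t'.1 i + t'.1 j ≠ 0 →
      sectorAngle i j (2 * a) t = sectorAngle i j (2 * b + 1) t' →
      M.point (walk i j φ (2 * a)) t = M.point (walk i j φ (2 * b + 1)) t' := by
    intro a b t t' hk hne hne' h
    have c0 := angleRatio_nonneg (i := i) (j := j) t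
    have c1 := angleRatio_le_one (i := i) (j := j) t
    have d0 := angleRatio_nonneg (i := i) (j := j) t'
    have d1 := angleRatio_le_one (i := i) (j := j) t'
    rw [sectorAngle_even, sectorAngle_odd] at h
    have e1 : ((2 * (a - b) : ℤ) : ℝ) ≤ (2 : ℤ) := by push_cast; linarith
    have e2 : ((0 : ℤ) : ℝ) ≤ (2 * (a - b) : ℤ) := by push_cast; linarith
    rw [Int.cast_le] at e1 e2
    obtain rfl | rfl : a = b ∨ a = b + 1 := by omega
    · have hc : angleRatio i j t = 0 := by linarith
      have hd : angleRatio i j t' = 0 := by linarith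
      obtain rfl := simplex_ext_of_angleRatio hij hik hjk hk hne (hc.trans hd.symm)
      rw [← r_fst_walk_even, point_r _ _ (fst_eq_zero_of_angleRatio hne hc)]
    · push_cast at h
      have hc : angleRatio i j t = 1 := by linarith
      have hd : angleRatio i j t' = 1 := by linarith
      obtain rfl := simplex_ext_of_angleRatio hij hik hjk hk hne (hc.trans hd.symm)
      rw [← r_snd_walk_odd, point_r _ _ (snd_eq_zero_of_angleRatio hne hc)]
  obtain ⟨a, rfl | rfl⟩ := Int.even_or_odd' n <;> obtain ⟨b, rfl | rfl⟩ := Int.even_or_odd' n'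
  · rw [sectorAngle_even, sectorAngle_even] at h
    have e1 : ((2 * (a - b) : ℤ) : ℝ) ≤ (1 : ℤ) := by push_cast; linarith
    have e2 : ((-1 : ℤ) : ℝ) ≤ (2 * (a - b) : ℤ) := by push_cast; linarith
    rw [Int.cast_le] at e1 e2
    obtain rfl : a = b := by omega
    rw [simplex_ext_of_angleRatio hij hik hjk hk hne (by linarith)]
  · exact mixed a b t t' hk hne hne' h
  · exact (mixed b a t' t hk.symm hne' hne h.symm).symm
  · rw [sectorAngle_odd, sectorAngle_odd] at h
    have e1 : ((2 * (a - b) : ℤ) : ℝ) ≤ (1 : ℤ) := by push_cast; linarith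
    have e2 : ((-1 : ℤ) : ℝ) ≤ (2 * (a - b) : ℤ) := by push_cast; linarith
    rw [Int.cast_le] at e1 e2
    obtain rfl : a = b := by omega
    rw [simplex_ext_of_angleRatio hij hik hjk hk hne (by linarith)]

end Sector

section Star

variable {M : SurfaceMap} {i j k : Fin 3}

open Classical in
/-- The open star of the corner `k` of the flag `φ`, drawn on the surface of a spindle whose other
end is the image of the complement of the star. -/
noncomputable def starMap (i j k : Fin 3) (φ : M.Flag) (m : ℕ) (p : M.Triangles) : ℂ × ℝ :=
  if h : ∃ n, walk i j φ n = p.1 then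
    ((p.2.1 k : ℂ) * sectorPoint i j m h.choose p.2, p.2.1 k)
  else 0

variable {φ : M.Flag} {m : ℕ}

theorem starMap_of_not_exists {ψ : M.Flag} (h : ¬ ∃ n, walk i j φ n = ψ)
    (t : stdSimplex ℝ (Fin 3)) : starMap i j k φ m ⟨ψ, t⟩ = 0 :=
  dif_neg h

theorem starMap_walk (hm : 0 < m)
    (hper : ∀ n n' : ℤ, walk i j φ n = walk i j φ n' ↔ ∃ l : ℤ, n = n' + 2 * m * l) (n : ℤ)
    (t : stdSimplex ℝ (Fin 3)) :
    starMap i j k φ m ⟨walk i j φ n, t⟩ = ((t.1 k : ℂ) * sectorPoint i j m n t, t.1 k) := by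
  have h : ∃ n', walk i j φ n' = walk i j φ n := ⟨n, rfl⟩
  obtain ⟨l, hl⟩ := (hper _ _).1 h.choose_spec
  rw [starMap, dif_pos h]
  dsimp only
  rw [hl, sectorPoint_periodic hm]

theorem starMap_glue (hij : i ≠ j) (hik : i ≠ k) (hjk : j ≠ k) (hm : 0 < m)
    (hper : ∀ n n' : ℤ, walk i j φ n = walk i j φ n' ↔ ∃ l : ℤ, n = n' + 2 * m * l)
    {p q : M.Triangles} (h : M.Glue p q) : starMap i j k φ m p = starMap i j k φ m q := by
  obtain ⟨l, ψ, t, ht⟩ := h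
  -- The factor `t.1 k` in `starMap` sends the side opposite the corner to `0`, the value outside
  -- the star, so gluing along that side is respected.
  by_cases hk : t.1 k = 0
  · have : ∀ ψ, starMap i j k φ m ⟨ψ, t⟩ = 0 := by
      intro ψ
      unfold starMap
      split_ifs <;> simp [hk]
    rw [this, this]
  by_cases hψ : ∃ n, walk i j φ n = ψ
  · obtain ⟨n, rfl⟩ := hψ
    obtain ⟨a, ha⟩ := Int.even_or_odd' n
    obtain rfl | rfl | rfl := Fin.eq_or_eq_or_eq_of_ne hij hik hjk l
    · obtain rfl | rfl := ha
      · rw [r_fst_walk_even, starMap_walk hm hper, starMap_walk hm hper,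
          sectorPoint_fst_side m a ht]
      · rw [r_fst_walk_odd, starMap_walk hm hper, starMap_walk hm hper,
          sectorPoint_fst_side m a ht]
    · obtain rfl | rfl := ha
      · obtain ⟨b, rfl⟩ : ∃ b, a = b + 1 := ⟨a - 1, by ring⟩
        rw [r_snd_walk_even, starMap_walk hm hper, starMap_walk hm hper,
          sectorPoint_snd_side m b ht]
      · rw [r_snd_walk_odd, starMap_walk hm hper, starMap_walk hm hper,
          sectorPoint_snd_side m a ht]
    · exact absurd ht hk
  · have hψ' : ¬ ∃ n, walk i j φ n = M.r l ψ := by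
      rintro ⟨n, hn⟩
      apply hψ
      rw [← M.r_r l ψ, ← hn]
      obtain rfl | rfl | rfl := Fin.eq_or_eq_or_eq_of_ne hij hik hjk l
      · exact exists_walk_eq_r_fst _ _ φ n
      · exact exists_walk_eq_r_snd _ _ φ n
      · exact absurd ht hk
    rw [starMap_of_not_exists hψ, starMap_of_not_exists hψ']

theorem starMap_norm (hij : i ≠ j) (hik : i ≠ k) (hjk : j ≠ k) (p : M.Triangles) :
    ‖(starMap i j k φ m p).1‖ =
      (starMap i j k φ m p).2 * (1 - (starMap i j k φ m p).2) := by
  unfold starMap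
  split_ifs
  · have h := simplex_sum hij hik hjk p.2
    rw [norm_mul, norm_sectorPoint, Complex.norm_real, Real.norm_of_nonneg (p.2.2.1 k)]
    congr 1
    linarith
  · simp

theorem point_eq_of_starMap_eq (hij : i ≠ j) (hik : i ≠ k) (hjk : j ≠ k) (hm : 0 < m)
    (hper : ∀ n n' : ℤ, walk i j φ n = walk i j φ n' ↔ ∃ l : ℤ, n = n' + 2 * m * l)
    {ψ ψ' : M.Flag} {t t' : stdSimplex ℝ (Fin 3)}
    (hpos : 0 < (starMap i j k φ m ⟨ψ, t⟩).2)
    (h : starMap i j k φ m ⟨ψ, t⟩ = starMap i j k φ m ⟨ψ', t'⟩) :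
    M.point ψ t = M.point ψ' t' := by
  have hmem : ∀ (ψ : M.Flag) (t : stdSimplex ℝ (Fin 3)),
      0 < (starMap i j k φ m ⟨ψ, t⟩).2 → ∃ n, walk i j φ n = ψ := by
    intro ψ t ht
    by_contra hcon
    rw [starMap_of_not_exists hcon] at ht
    exact lt_irrefl _ ht
  obtain ⟨n, rfl⟩ := hmem ψ t hpos
  obtain ⟨n', rfl⟩ := hmem ψ' t' (h ▸ hpos)
  rw [starMap_walk hm hper] at hpos
  rw [starMap_walk hm hper, starMap_walk hm hper, Prod.mk.injEq] at h
  obtain ⟨h1, h2⟩ := h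
  have hk : (t'.1 k : ℂ) ≠ 0 := by
    rw [← h2]
    exact_mod_cast (show 0 < t.1 k from hpos).ne'
  rw [h2, mul_right_inj' hk] at h1
  have s1 := simplex_sum hij hik hjk t
  have s2 := simplex_sum hij hik hjk t'
  by_cases hzero : t.1 i + t.1 j = 0
  · have hi : t.1 i = 0 := by linarith [t.2.1 i, t.2.1 j]
    have hj : t.1 j = 0 := by linarith
    have hi' : t'.1 i = 0 := by linarith [t'.2.1 i, t'.2.1 j]
    obtain rfl := simplex_ext hij hik hjk (hi.trans hi'.symm) h2
    rw [point_walk _ _ _ hi hj, point_walk _ _ _ hi hj]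
  · have hsum : t'.1 i + t'.1 j = t.1 i + t.1 j := by linarith
    have hzero' : ((t.1 i + t.1 j : ℝ) : ℂ) ≠ 0 := by exact_mod_cast hzero
    rw [sectorPoint, sectorPoint, hsum, mul_right_inj' hzero', exp_angle_eq_iff hm] at h1
    obtain ⟨l, hl⟩ := h1
    -- Renumbering the second flag by whole turns makes the angles equal, not merely congruent.
    rw [(hper (n' + 2 * m * l) n').2 ⟨l, rfl⟩ |>.symm]
    refine point_walk_eq_of_sectorAngle_eq hij hik hjk φ h2 hzero ?_
    rw [hl, mul_assoc, mul_assoc, sectorAngle_add]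
    push_cast
    ring

/-- Collapsing the complement of the star to one point makes the chart data a global continuous map.
Its values at positive height determine the point, which gives separation and, after division by the
height, a chart onto the disc. -/
theorem exists_star (hij : i ≠ j) (hik : i ≠ k) (hjk : j ≠ k) [Finite M.Flag]
    {o : M.Flag → ℤˣ} (ho : ∀ i φ, o (M.r i φ) = - o φ) (φ : M.Flag) :
    ∃ F : M.Surface → ℂ × ℝ, Continuous F ∧ (∀ x y, 0 < (F x).2 → F x = F y → x = y) ∧
      (∀ x, ‖(F x).1‖ = (F x).2 * (1 - (F x).2)) ∧
      (∀ w : ℂ, ‖w‖ < 1 → ∃ x, F x = ((1 - ‖w‖ : ℝ) * w, 1 - ‖w‖)) ∧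
      (∀ t, (F (M.point φ t)).2 = t.1 k) ∧
      ∀ σ : M.Aut, σ.1 φ = M.r i φ → ∀ x, F (act σ x) = ((starRingEnd ℂ) (F x).1, (F x).2) := by
  obtain ⟨m, hm, hper⟩ := exists_period i j φ ho
  refine ⟨Quot.lift (starMap i j k φ m) fun p q => starMap_glue hij hik hjk hm hper,
    ?_, ?_, ?_, ?_, ?_, ?_⟩
  · refine continuous_quot_lift _ (continuous_sigma fun ψ => ?_)
    by_cases hψ : ∃ n, walk i j φ n = ψ
    · obtain ⟨n, rfl⟩ := hψ
      simp only [starMap_walk hm hper]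
      have hk : Continuous fun t : stdSimplex ℝ (Fin 3) => t.1 k :=
        (continuous_apply k).comp continuous_subtype_val
      exact ((Complex.continuous_ofReal.comp hk).mul (continuous_sectorPoint m n)).prodMk hk
    · simp only [starMap_of_not_exists hψ]
      exact continuous_const
  · intro x y
    obtain ⟨ψ, t, rfl⟩ := exists_point x
    obtain ⟨ψ', t', rfl⟩ := exists_point y
    exact point_eq_of_starMap_eq hij hik hjk hm hper
  · intro x
    obtain ⟨ψ, t, rfl⟩ := exists_point x
    exact starMap_norm hij hik hjk _
  · intro w hw
    obtain ⟨n, t, h1, h2⟩ := exists_sectorPoint_eq hij hik hjk hm hw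
    refine ⟨M.point (walk i j φ n) t, ?_⟩
    refine (starMap_walk hm hper n t).trans ?_
    rw [h1, h2]
  · intro t
    have := starMap_walk (k := k) hm hper 0 t
    rw [walk_zero] at this
    exact congrArg Prod.snd this
  · intro σ hσ x
    obtain ⟨ψ, t, rfl⟩ := exists_point x
    change starMap i j k φ m ⟨σ.1 ψ, t⟩ = ((starRingEnd ℂ) (starMap i j k φ m ⟨ψ, t⟩).1,
      (starMap i j k φ m ⟨ψ, t⟩).2)
    by_cases hψ : ∃ n, walk i j φ n = ψ
    · obtain ⟨n, rfl⟩ := hψ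
      rw [aut_walk i j φ hσ, starMap_walk hm hper, starMap_walk hm hper, sectorPoint_one_sub,
        map_mul, Complex.conj_ofReal]
    · have hψ' : ¬ ∃ n, walk i j φ n = σ.1 ψ := by
        rintro ⟨n, hn⟩
        refine hψ ⟨1 - n, σ.1.injective ?_⟩
        rw [aut_walk i j φ hσ, sub_sub_cancel, hn]
      rw [starMap_of_not_exists hψ, starMap_of_not_exists hψ']
      simp [Prod.zero_eq_mk]

end Star

end SurfaceMap

/-! ### The surface is closed; reflections in terms of flags. -/

namespace SurfaceMap

variable {M : SurfaceMap}

theorem exists_three_of_ne (k : Fin 3) : ∃ i j : Fin 3, i ≠ j ∧ i ≠ k ∧ j ≠ k := by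
  decide +revert

theorem exists_ne_of_two (i j : Fin 3) : ∃ k : Fin 3, i ≠ k ∧ j ≠ k := by
  decide +revert

theorem exists_coordinate_pos (t : stdSimplex ℝ (Fin 3)) : ∃ k, 0 < t.1 k := by
  by_contra! h
  have h1 : ∑ l, t.1 l = 1 := t.2.2
  have h2 := Finset.sum_nonpos fun l (_ : l ∈ Finset.univ) => h l
  linarith

theorem connectedSpace_surface (M : SurfaceMap) : ConnectedSpace M.Surface := by
  have hpoint : ∀ φ : M.Flag, Continuous (M.point φ) := fun φ =>
    continuous_quot_mk.comp continuous_sigmaMk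
  have htri : ∀ (φ : M.Flag) t t',
      connectedComponent (M.point φ t) = connectedComponent (M.point φ t') := by
    intro φ t t'
    refine connectedComponent_eq ?_
    exact (isPreconnected_range (hpoint φ)).subset_connectedComponent ⟨t, rfl⟩ ⟨t', rfl⟩
  have hr : ∀ (i : Fin 3) (φ : M.Flag) t t',
      connectedComponent (M.point (M.r i φ) t) = connectedComponent (M.point φ t') := by
    intro i φ t t'
    obtain ⟨j, hj⟩ : ∃ j, i ≠ j := by decide +revert
    let s : stdSimplex ℝ (Fin 3) := ⟨Pi.single j 1, single_mem_stdSimplex ℝ j⟩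
    rw [htri _ t s, htri _ t' s, point_r]
    simp [s, hj]
  have hg : ∀ g ∈ Subgroup.closure (Set.range M.r), ∀ (φ : M.Flag) t t',
      connectedComponent (M.point (g φ) t) = connectedComponent (M.point φ t') := by
    intro g hg
    induction hg using Subgroup.closure_induction with
    | mem g hg =>
      obtain ⟨i, rfl⟩ := hg
      exact hr i
    | one => exact htri
    | mul g h _ _ ihg ihh =>
      intro φ t t'
      rw [Equiv.Perm.mul_apply, ihg _ t t', ihh _ t' t']
    | inv g _ ih =>
      intro φ t t'
      have := ih (g⁻¹ φ) t' t
      rw [show g (g⁻¹ φ) = φ from Equiv.apply_symm_apply g φ] at this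
      exact this.symm
  obtain ⟨φ⟩ := M.nonempty
  let s : stdSimplex ℝ (Fin 3) := ⟨Pi.single 0 1, single_mem_stdSimplex ℝ 0⟩
  rw [connectedSpace_iff_connectedComponent]
  refine ⟨M.point φ s, Set.eq_univ_of_forall fun x => ?_⟩
  obtain ⟨ψ, t, rfl⟩ := exists_point x
  obtain ⟨g, hgc, rfl⟩ := M.transitive φ ψ
  rw [← hg g hgc φ t s]
  exact mem_connectedComponent

theorem compactSpace_surface (M : SurfaceMap) [Finite M.Flag] : CompactSpace M.Surface :=
  inferInstanceAs (CompactSpace (Quot M.Glue))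

theorem isClosedSurface [Finite M.Flag] {o : M.Flag → ℤˣ} (ho : ∀ i φ, o (M.r i φ) = - o φ) :
    IsClosedSurface M.Surface := by
  have hc := compactSpace_surface M
  have hstar : ∀ x : M.Surface, ∃ F : M.Surface → ℂ × ℝ, Continuous F ∧
      (∀ x y, 0 < (F x).2 → F x = F y → x = y) ∧
      (∀ x, ‖(F x).1‖ = (F x).2 * (1 - (F x).2)) ∧
      (∀ w : ℂ, ‖w‖ < 1 → ∃ x, F x = ((1 - ‖w‖ : ℝ) * w, 1 - ‖w‖)) ∧ 0 < (F x).2 := by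
    intro x
    obtain ⟨φ, t, rfl⟩ := exists_point x
    obtain ⟨k, hk⟩ := exists_coordinate_pos t
    obtain ⟨i, j, hij, hik, hjk⟩ := exists_three_of_ne k
    obtain ⟨F, h1, h2, h3, h4, h5, -⟩ := exists_star hij hik hjk ho φ
    exact ⟨F, h1, h2, h3, h4, by rwa [h5]⟩
  refine ⟨hc, connectedSpace_surface M, ⟨fun x y hxy => ?_⟩, fun x => ?_⟩
  · obtain ⟨F, h1, h2, -, -, h5⟩ := hstar x
    exact separated_by_continuous h1 fun h => hxy (h2 x y h5 h)
  · obtain ⟨F, h1, h2, h3, h4, h5⟩ := hstar x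
    obtain ⟨e, he, -⟩ := exists_openPartialHomeomorph_ball h1 h2 (fun x _ => h3 x) h4
    exact ⟨e, he ▸ h5⟩

theorem isReflection_of_eq_r [Finite M.Flag] {o : M.Flag → ℤˣ}
    (ho : ∀ i φ, o (M.r i φ) = - o φ) {σ : M.Aut} {φ : M.Flag} {i : Fin 3}
    (h : σ.1 φ = M.r i φ) : IsReflection σ := by
  have hc := compactSpace_surface M
  obtain ⟨j, k, hjk, hji, hki⟩ := exists_three_of_ne i
  obtain ⟨F, h1, h2, h3, h4, h5, h6⟩ := exists_star hji.symm hki.symm hjk ho φ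
  obtain ⟨e, hs, ht, he⟩ := exists_openPartialHomeomorph_ball h1 h2 (fun x _ => h3 x) h4
  refine ⟨M.point φ ⟨Pi.single k 1, single_mem_stdSimplex ℝ k⟩, e, ?_, ?_, ht, ?_⟩
  · rw [act_point, h, point_r]
    simp [hki]
  · rw [hs, Set.mem_ofPred_eq, h5]
    simp
  · intro y hy
    rw [hs, Set.mem_ofPred_eq] at hy ⊢
    rw [he, he, h6 σ h, map_div₀, Complex.conj_ofReal]
    exact ⟨hy, rfl⟩

/-- A point that is not a corner lies on at most one side of its triangle, so its gluing class has
at most two members. The predicate `S` describes this class and is invariant under gluing. -/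
theorem eq_or_eq_r_of_point_eq {φ ψ : M.Flag} {t : stdSimplex ℝ (Fin 3)}
    (ht : ∀ i j, t.1 i = 0 → t.1 j = 0 → i = j) (h : M.point ψ t = M.point φ t) :
    ψ = φ ∨ ∃ i, ψ = M.r i φ := by
  let S : M.Surface → Prop := Quot.lift
    (fun p => p.2 = t ∧ (p.1 = φ ∨ ∃ i, t.1 i = 0 ∧ p.1 = M.r i φ)) (by
      rintro _ _ ⟨i, υ, s, hs⟩
      refine propext (and_congr_right fun hst => ?_)
      dsimp only at hst ⊢
      subst hst
      constructor
      · rintro (rfl | ⟨l, hl, rfl⟩)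
        · exact Or.inr ⟨i, hs, rfl⟩
        · obtain rfl := ht _ _ hs hl
          exact Or.inl (M.r_r _ _)
      · rintro (h | ⟨l, hl, h⟩)
        · exact Or.inr ⟨i, hs, by rw [← h, r_r]⟩
        · obtain rfl := ht _ _ hs hl
          exact Or.inl ((M.r i).injective h))
  have h1 : S (M.point φ t) := ⟨rfl, Or.inl rfl⟩
  rw [← h] at h1
  obtain ⟨-, h | ⟨i, -, h⟩⟩ := h1
  · exact Or.inl h
  · exact Or.inr ⟨i, h⟩

/-- The real segment of the disc consists of infinitely many fixed points, while there are finitely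
many corners; a fixed point off the corners forces its flag to be fixed or sent to a neighbour. A
fixed flag would give the identity, but conjugation moves `i / 2`. -/
theorem exists_eq_r_of_isReflection [Finite M.Flag] {σ : M.Aut} (h : IsReflection σ) :
    ∃ φ i, σ.1 φ = M.r i φ := by
  obtain ⟨x, e, -, -, ht, hy⟩ := h
  have hball : ∀ w : ℂ, ‖w‖ < 1 → w ∈ e.target := fun w hw => by rw [ht]; simpa using hw
  have hact : ∀ w : ℂ, ‖w‖ < 1 → (starRingEnd ℂ) w = w → act σ (e.symm w) = e.symm w := by
    intro w hw hc
    have h1 := e.map_target (hball w hw)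
    obtain ⟨h2, h3⟩ := hy _ h1
    refine e.injOn h2 h1 ?_
    rw [h3, e.right_inv (hball w hw), hc]
  have hcorner : (Set.range fun p : M.Flag × Fin 3 =>
      M.point p.1 ⟨Pi.single p.2 1, single_mem_stdSimplex ℝ p.2⟩).Finite := Set.finite_range _
  have hinf : ((fun a : ℝ => e.symm (a : ℂ)) '' Set.Ioo 0 1).Infinite := by
    refine (Set.Ioo_infinite zero_lt_one).image fun a ha b hb hab => ?_
    have hn : ∀ a : ℝ, a ∈ Set.Ioo (0 : ℝ) 1 → ‖(a : ℂ)‖ < 1 := fun a ha => by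
      rw [Complex.norm_real, Real.norm_of_nonneg ha.1.le]
      exact ha.2
    exact_mod_cast e.symm.injOn (hball _ (hn a ha)) (hball _ (hn b hb)) hab
  obtain ⟨_, ⟨a, ha, rfl⟩, hnot⟩ := hinf.exists_notMem_finite hcorner
  have hfix := hact a (by
    rw [Complex.norm_real, Real.norm_of_nonneg ha.1.le]
    exact ha.2) (Complex.conj_ofReal a)
  obtain ⟨φ, t, hpt⟩ := exists_point (e.symm (a : ℂ))
  simp only [hpt] at hnot hfix
  rw [act_point] at hfix
  have hzero : ∀ i j, t.1 i = 0 → t.1 j = 0 → i = j := by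
    intro i j hi hj
    by_contra hij
    obtain ⟨k, hik, hjk⟩ := exists_ne_of_two i j
    refine hnot ⟨(φ, k), ?_⟩
    have hk := simplex_sum hij hik hjk t
    dsimp only
    congr 1
    refine simplex_ext hij hik hjk ?_ ?_
    · simp [hi, hik]
    · rw [hi, hj] at hk
      simpa using hk.symm
  obtain h | ⟨i, h⟩ := eq_or_eq_r_of_point_eq hzero hfix
  · exfalso
    have h1 : σ = 1 := aut_ext (φ := φ) h
    have h2 : ∀ y, act σ y = y := by
      intro y
      obtain ⟨ψ, s, rfl⟩ := exists_point y
      rw [act_point, h1]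
      rfl
    have hw : ‖((1 / 2 : ℝ) * Complex.I)‖ < 1 := by
      rw [norm_mul, Complex.norm_real, Complex.norm_I]
      norm_num
    have h3 := (hy _ (e.map_target (hball _ hw))).2
    rw [h2, e.right_inv (hball _ hw), map_mul, Complex.conj_ofReal, Complex.conj_I] at h3
    have := congrArg Complex.im h3
    simp only [Complex.im_ofReal_mul, Complex.neg_im, Complex.I_im] at this
    norm_num at this
  · exact ⟨φ, i, h⟩

theorem isReflection_iff [Finite M.Flag] {o : M.Flag → ℤˣ}
    (ho : ∀ i φ, o (M.r i φ) = - o φ) (σ : M.Aut) :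
    IsReflection σ ↔ ∃ φ i, σ.1 φ = M.r i φ :=
  ⟨exists_eq_r_of_isReflection, fun ⟨_, _, h⟩ => isReflection_of_eq_r ho h⟩

end SurfaceMap

/-! ### Cayley maps. -/

/-- A rotation system for a Cayley graph of `G`: the darts at a vertex in their cyclic order, their
labels in `G`, and a sign of `G` that tells which elements reverse the orientation. -/
structure CayleySystem (G : Type) [Group G] where
  /-- The darts at a vertex. -/
  Dart : Type
  /-- The cyclic order of the darts at a vertex. -/
  next : Equiv.Perm Dart
  /-- The dart at the other end of an edge. -/
  rev : Dart → Dart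
  /-- The quotient of the vertices at the two ends of an edge. -/
  label : Dart → G
  /-- The orientation character. -/
  sign : G →* ℤˣ
  nonempty : Nonempty Dart
  rev_rev : ∀ d, rev (rev d) = d
  label_rev : ∀ d, label (rev d) = (label d)⁻¹
  closure_label : Subgroup.closure (Set.range label) = ⊤
  next_transitive : ∀ d d', ∃ n : ℤ, (next ^ n) d = d'

namespace CayleySystem

open SurfaceMap

variable {G : Type} [Group G] (C : CayleySystem G)

/-- The flags of the map of a rotation system: a vertex, a dart, and a side of the dart. -/
abbrev MapFlag : Type := G × C.Dart × ℤˣ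

/-- The passage to the other end of the edge. -/
def flipVertex : Equiv.Perm C.MapFlag :=
  Function.Involutive.toPerm
    -- Sides are measured in the local orientation of the vertex, so the sign of the label corrects
    -- for the change of orientation along the edge.
    (fun φ => (φ.1 * C.label φ.2.1, C.rev φ.2.1, -(C.sign (C.label φ.2.1) * φ.2.2)))
    fun φ => by
      simp only [C.rev_rev, C.label_rev, map_inv, Int.units_inv_eq_self, mul_inv_cancel_right,
        mul_neg, neg_neg, ← mul_assoc, Int.units_mul_self, one_mul]

/-- The passage to the neighbouring dart. -/
def flipEdge : Equiv.Perm C.MapFlag :=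
  Function.Involutive.toPerm
    (fun φ => (φ.1, (C.next ^ (φ.2.2 : ℤ)) φ.2.1, -φ.2.2))
    fun φ => by
      simp only [neg_neg, Units.val_neg, ← Equiv.Perm.mul_apply, ← zpow_add, neg_add_cancel,
        zpow_zero, Equiv.Perm.one_apply]

/-- The passage to the other side of the dart. -/
def flipFace : Equiv.Perm C.MapFlag :=
  Function.Involutive.toPerm (fun φ => (φ.1, φ.2.1, -φ.2.2)) fun φ => by simp only [neg_neg]

/-- The three adjacencies of the flags. -/
def flip : Fin 3 → Equiv.Perm C.MapFlag := ![C.flipVertex, C.flipEdge, C.flipFace]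

theorem flip_zero (g : G) (d : C.Dart) (ε : ℤˣ) :
    C.flip 0 (g, d, ε) = (g * C.label d, C.rev d, -(C.sign (C.label d) * ε)) := rfl

theorem flip_one (g : G) (d : C.Dart) (ε : ℤˣ) :
    C.flip 1 (g, d, ε) = (g, (C.next ^ (ε : ℤ)) d, -ε) := rfl

theorem flip_two (g : G) (d : C.Dart) (ε : ℤˣ) : C.flip 2 (g, d, ε) = (g, d, -ε) := rfl

theorem flip_one_pos (g : G) (d : C.Dart) : C.flip 1 (g, d, 1) = (g, C.next d, -1) := by
  rw [flip_one]; simp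

theorem flip_one_neg (g : G) (d : C.Dart) : C.flip 1 (g, d, -1) = (g, C.next⁻¹ d, 1) := by
  rw [flip_one]; simp

theorem eq_of_flip_invariant {α : Type*} (f : C.MapFlag → α) (h1 : ∀ φ, f (C.flip 1 φ) = f φ)
    (h2 : ∀ φ, f (C.flip 2 φ) = f φ) (g : G) (d d' : C.Dart) (ε ε' : ℤˣ) :
    f (g, d, ε) = f (g, d', ε') := by
  have hε : ∀ (d : C.Dart) (ε : ℤˣ), f (g, d, ε) = f (g, d, 1) := by
    intro d ε
    obtain rfl | rfl := Int.units_eq_one_or ε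
    · rfl
    · rw [← C.flip_two, h2]
  have hnext : ∀ d, f (g, C.next d, 1) = f (g, d, 1) := by
    intro d
    rw [← hε (C.next d) (-1), ← C.flip_one_pos, h1]
  have hpow : ∀ n : ℤ, f (g, (C.next ^ n) d, 1) = f (g, d, 1) := by
    intro n
    induction n using Int.induction_on with
    | zero => simp
    | succ n ih => rw [add_comm, zpow_one_add, Equiv.Perm.mul_apply, hnext, ih]
    | pred n ih =>
      rw [← hnext, ← Equiv.Perm.mul_apply, ← zpow_one_add, add_sub_cancel, ih]
  obtain ⟨n, rfl⟩ := C.next_transitive d d'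
  rw [hε _ ε', hpow, hε]

/-- Connectedness in the form of invariant functions: `flip 1` and `flip 2` reach all flags at a
vertex, and `flip 0` moves between vertices by the labels, which generate `G`. Taking for `f` the
orbit of a flag gives transitivity. -/
theorem eq_of_flip_invariant_of_forall {α : Type*} (f : C.MapFlag → α)
    (h : ∀ i φ, f (C.flip i φ) = f φ) (φ ψ : C.MapFlag) : f φ = f ψ := by
  obtain ⟨d₀⟩ := C.nonempty
  have key := C.eq_of_flip_invariant f (h 1) (h 2)
  have hlab : ∀ y ∈ Subgroup.closure (Set.range C.label), ∀ g,
      f (g * y, d₀, 1) = f (g, d₀, 1) := by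
    intro y hy
    induction hy using Subgroup.closure_induction with
    | mem y hy =>
      obtain ⟨d, rfl⟩ := hy
      intro g
      have := h 0 (g, d, 1)
      rw [flip_zero] at this
      rw [key _ d₀ (C.rev d) _ (-(C.sign (C.label d) * 1)), this, key]
    | one => simp
    | mul y z _ _ ihy ihz =>
      intro g
      rw [← mul_assoc, ihz, ihy]
    | inv y _ ih =>
      intro g
      rw [← ih, inv_mul_cancel_right]
  obtain ⟨g, d, ε⟩ := φ
  obtain ⟨g', d', ε'⟩ := ψ
  rw [key g d d₀ ε 1, key g' d' d₀ ε' 1,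
    ← hlab (g⁻¹ * g') (by rw [C.closure_label]; trivial) g, mul_inv_cancel_left]

/-- The map of a rotation system. -/
def toMap : SurfaceMap where
  Flag := C.MapFlag
  r := C.flip
  nonempty := let ⟨d⟩ := C.nonempty; ⟨(1, d, 1)⟩
  r_sq i := by
    refine Equiv.ext fun φ => ?_
    rw [sq, Equiv.Perm.mul_apply]
    fin_cases i
    · exact C.flipVertex.left_inv φ
    · exact C.flipEdge.left_inv φ
    · exact C.flipFace.left_inv φ
  r_zero_r_two_sq := by
    refine Equiv.ext fun ⟨g, d, ε⟩ => ?_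
    simp only [sq, Equiv.Perm.mul_apply, flip_zero, flip_two, C.rev_rev, C.label_rev,
      map_inv, Int.units_inv_eq_self, mul_inv_cancel_right, mul_neg, neg_neg, ← mul_assoc,
      Int.units_mul_self, one_mul, Equiv.Perm.one_apply]
  transitive φ ψ := by
    let H := Subgroup.closure (Set.range C.flip)
    have := C.eq_of_flip_invariant_of_forall (fun φ => MulAction.orbit H φ)
      (fun i φ => MulAction.orbit_eq_iff.2
        ⟨⟨C.flip i, Subgroup.subset_closure ⟨i, rfl⟩⟩, rfl⟩) ψ φ
    obtain ⟨g, hg⟩ := MulAction.orbit_eq_iff.1 this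
    exact ⟨g.1, g.2, hg⟩

/-- The orientation of the triangles of the map of a rotation system. -/
def orientation (φ : C.toMap.Flag) : ℤˣ := C.sign (φ : C.MapFlag).1 * (φ : C.MapFlag).2.2

theorem orientation_r (i : Fin 3) (φ : C.toMap.Flag) :
    C.orientation (C.toMap.r i φ) = - C.orientation φ := by
  obtain ⟨g, d, ε⟩ := φ
  fin_cases i
  · change C.sign (g * C.label d) * -(C.sign (C.label d) * ε) = -(C.sign g * ε)
    rw [map_mul, mul_neg, mul_assoc, ← mul_assoc (C.sign (C.label d)), Int.units_mul_self, one_mul]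
  · exact mul_neg _ _
  · exact mul_neg _ _

theorem finite_flag [Finite G] [Finite C.Dart] : Finite C.toMap.Flag :=
  inferInstanceAs (Finite (G × C.Dart × ℤˣ))

theorem noFreeEdges (h : ∀ d, C.rev d = d → C.label d ≠ 1) : C.toMap.NoFreeEdges := by
  rintro ⟨g, d, ε⟩ heq
  change C.flip 0 (g, d, ε) = C.flip 2 (g, d, ε) at heq
  rw [flip_zero, flip_two, Prod.mk.injEq, Prod.mk.injEq] at heq
  exact h d heq.2.1 (mul_eq_left.1 heq.1)

/-- The left multiplication by an element of `G`, as a permutation of the flags. -/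
def leftPerm (h : G) : Equiv.Perm C.MapFlag := (Equiv.mulLeft h).prodCongr (Equiv.refl _)

theorem leftPerm_flip (h : G) (i : Fin 3) (φ : C.MapFlag) :
    C.leftPerm h (C.flip i φ) = C.flip i (C.leftPerm h φ) := by
  obtain ⟨g, d, ε⟩ := φ
  fin_cases i
  · exact congrArg (·, C.rev d, -(C.sign (C.label d) * ε)) (mul_assoc h g (C.label d)).symm
  · rfl
  · rfl

/-- The action of `G` on the map by left multiplication. -/
def leftMul : G →* C.toMap.Aut where
  toFun h := ⟨C.leftPerm h, Subgroup.mem_centralizer_iff.2 (by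
    rintro _ ⟨i, rfl⟩
    exact Equiv.ext fun φ => (C.leftPerm_flip h i φ).symm)⟩
  map_one' := Subtype.ext (Equiv.ext fun ⟨g, d, ε⟩ => congrArg (·, d, ε) (one_mul g))
  map_mul' h h' := Subtype.ext (Equiv.ext fun ⟨g, d, ε⟩ => congrArg (·, d, ε) (mul_assoc h h' g))

theorem leftMul_apply (h g : G) (d : C.Dart) (ε : ℤˣ) :
    (C.leftMul h).1 (g, d, ε) = (h * g, d, ε) := rfl

theorem leftMul_injective : Function.Injective C.leftMul := by
  intro h h' heq
  obtain ⟨d⟩ := C.nonempty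
  have := congrArg (fun σ : C.toMap.Aut => (σ.1 (1, d, 1) : C.MapFlag).1) heq
  simpa only [leftMul_apply, mul_one] using this

theorem vertexTransitive : C.toMap.VertexTransitive := by
  rintro ⟨g, d, ε⟩ ⟨g', d', ε'⟩
  refine ⟨C.leftMul (g' * g⁻¹), ?_⟩
  have h1 : act (C.leftMul (g' * g⁻¹)) (C.toMap.vertex (g, d, ε)) =
      C.toMap.vertex (g' * g⁻¹ * g, d, ε) := rfl
  rw [h1, inv_mul_cancel_right]
  exact C.eq_of_flip_invariant C.toMap.vertex
    (fun φ => point_r (M := C.toMap) (i := 1) φ (by simp))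
    (fun φ => point_r (M := C.toMap) (i := 2) φ (by simp)) _ _ _ _ _

theorem isReflection_leftMul_iff [Finite G] [Finite C.Dart] (h : G) :
    IsReflection (C.leftMul h) ↔
      ∃ g d, C.rev d = d ∧ C.sign (C.label d) = -1 ∧ h = g * C.label d * g⁻¹ := by
  have := C.finite_flag
  have hne : ∀ u : ℤˣ, u ≠ -u := by decide
  rw [isReflection_iff C.orientation_r]
  constructor
  · rintro ⟨⟨g, d, ε⟩, i, heq⟩
    rw [leftMul_apply] at heq
    change _ = C.flip i (g, d, ε) at heq
    obtain rfl | rfl | rfl : i = 0 ∨ i = 1 ∨ i = 2 := by omega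
    · rw [flip_zero, Prod.mk.injEq, Prod.mk.injEq] at heq
      obtain ⟨h1, h2, h3⟩ := heq
      refine ⟨g, d, h2.symm, ?_, by rw [← h1, mul_inv_cancel_right]⟩
      rw [← neg_mul, eq_comm, mul_eq_right, neg_eq_iff_eq_neg] at h3
      exact h3
    · exact absurd (congrArg (fun φ : C.MapFlag => φ.2.2) heq) (hne _)
    · exact absurd (congrArg (fun φ : C.MapFlag => φ.2.2) heq) (hne _)
  · rintro ⟨g, d, h1, h2, rfl⟩
    refine ⟨(g, d, 1), 0, ?_⟩
    change _ = C.flip 0 (g, d, 1)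
    rw [leftMul_apply, flip_zero, h1, h2, inv_mul_cancel_right]
    simp

end CayleySystem

/-! ### A rotation system without extra automorphisms. -/

theorem exists_cyclic_perm (E : Type) [Finite E] [Nonempty E] :
    ∃ s : Equiv.Perm (Fin 5 ⊕ E), s (.inl 0) = .inl 1 ∧ s (.inl 1) = .inl 2 ∧
      s (.inl 2) = .inl 3 ∧ s (.inl 3) = .inl 4 ∧ (∃ e, s (.inl 4) = .inr e) ∧
      (∃ e, s (.inr e) = .inl 0) ∧ ∀ d d', ∃ n : ℤ, (s ^ n) d = d' := by
  classical
  have := Fintype.ofFinite E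
  obtain ⟨e, E', hE⟩ : ∃ e E', (Finset.univ : Finset E).toList = e :: E' := by
    refine List.exists_cons_of_ne_nil ?_
    simp [Finset.univ_nonempty.ne_empty]
  have hnd : (e :: E').Nodup := hE ▸ Finset.nodup_toList _
  have hmem : ∀ x : E, x ∈ e :: E' := fun x => by simp [← hE]
  set l : List (Fin 5 ⊕ E) := (.inl 0 :: .inl 1 :: .inl 2 :: .inl 3 :: .inl 4 ::
    (e :: E').map .inr) with hl
  have hl' : l = (List.finRange 5).map .inl ++ (e :: E').map .inr := by
    rw [hl]; rfl
  have hlnd : l.Nodup := by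
    rw [hl', List.nodup_append]
    refine ⟨(List.nodup_finRange 5).map Sum.inl_injective, hnd.map Sum.inr_injective, ?_⟩
    simp
  have hlmem : ∀ x, x ∈ l := by
    rintro (x | x)
    · rw [hl']
      simp
    · rw [hl', List.mem_append]
      exact Or.inr (List.mem_map_of_mem (hmem x))
  have hlt := fun n hn => List.formPerm_apply_lt_getElem l hlnd n hn
  refine ⟨l.formPerm, hlt 0 (by simp [hl]), hlt 1 (by simp [hl]), hlt 2 (by simp [hl]),
    hlt 3 (by simp [hl]), ⟨e, hlt 4 (by simp [hl])⟩, ?_, ?_⟩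
  · have h1 := List.formPerm_apply_getLast (.inl 0) (.inl 1 :: .inl 2 :: .inl 3 :: .inl 4 ::
      (e :: E').map (.inr : E → Fin 5 ⊕ E))
    refine ⟨(e :: E').getLast (by simp), ?_⟩
    rw [← h1]
    congr 1
    simp only [List.map_cons, List.getLast_cons_cons]
    exact (List.getLast_map (f := (.inr : E → Fin 5 ⊕ E)) (l := e :: E') (by simp)).symm
  · intro d d'
    exact (hlnd.isCycleOn_formPerm).2 (hlmem d) (hlmem d')

open SurfaceMap

section Rigid

variable {G : Type} [Group G] (sgn : G →* ℤˣ) (T : Set G)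

/-- The darts of a rotation system in which the elements of `T` act as reflections: five darts that
break all symmetry, a pair of darts for every nontrivial element of `G`, and a dart for every
element of `T`. -/
abbrev RigidDart : Type := Fin 5 ⊕ ({g : G // g ≠ 1} × Bool ⊕ T)

namespace RigidDart

variable {T}

/-- The reversal of darts. The first five contain two loops. -/
def rev : RigidDart T → RigidDart T
  | .inl a => .inl (![1, 0, 4, 3, 2] a)
  | .inr (.inl (g, b)) => .inr (.inl (g, !b))
  | .inr (.inr t) => .inr (.inr t)

/-- The labels of the darts, where `t₀` labels the only one of the first five that
is not an end of a loop. -/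
def label (t₀ : T) : RigidDart T → G
  | .inl a => if a = 3 then t₀ else 1
  | .inr (.inl (g, b)) => if b then g else g⁻¹
  | .inr (.inr t) => t

theorem rev_rev (d : RigidDart T) : rev (rev d) = d := by
  rcases d with a | ⟨g, b⟩ | t
  · fin_cases a <;> rfl
  · simp [rev]
  · rfl

theorem label_inl (t₀ : T) {a : Fin 5} (ha : a ≠ 3) : label t₀ (.inl a) = 1 := if_neg ha

theorem label_rev (hT : ∀ t ∈ T, orderOf t = 2) (t₀ : T) (d : RigidDart T) :
    label t₀ (rev d) = (label t₀ d)⁻¹ := by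
  have hinv : ∀ t : T, (t : G) = (t : G)⁻¹ := fun t => by
    have := pow_orderOf_eq_one (t : G)
    rw [hT t t.2, sq] at this
    exact eq_inv_of_mul_eq_one_left this
  rcases d with a | ⟨g, b⟩ | t
  · fin_cases a
    · simp [rev, label]
    · simp [rev, label]
    · simp [rev, label]
    · exact hinv t₀
    · simp [rev, label]
  · cases b <;> simp [rev, label]
  · exact hinv t

theorem label_eq_one (hT : ∀ t ∈ T, orderOf t = 2) {t₀ : T} {d : RigidDart T}
    (h : label t₀ d = 1) :
    ∃ a : Fin 5, a ≠ 3 ∧ d = .inl a := by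
  have hne : ∀ t : T, (t : G) ≠ 1 := fun t ht => by
    have := hT t t.2
    rw [ht, orderOf_one] at this
    omega
  rcases d with a | ⟨g, b⟩ | t
  · refine ⟨a, ?_, rfl⟩
    rintro rfl
    exact hne t₀ h
  · cases b
    · exact absurd (inv_eq_one.1 h) g.2
    · exact absurd h g.2
  · exact absurd h (hne t)

end RigidDart

theorem exists_rigid_cayleySystem [Finite G] (hT : ∀ t ∈ T, orderOf t = 2)
    (hne : T.Nonempty) :
    ∃ C : CayleySystem G, Finite C.Dart ∧ C.sign = sgn ∧
      (∀ d, C.rev d = d → C.label d ∈ T) ∧ (∀ t ∈ T, ∃ d, C.rev d = d ∧ C.label d = t) ∧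
      Function.Surjective C.leftMul := by
  obtain ⟨t₀, ht₀⟩ := hne
  have : Nonempty ({g : G // g ≠ 1} × Bool ⊕ T) := ⟨.inr ⟨t₀, ht₀⟩⟩
  obtain ⟨s, s0, s1, s2, s3, ⟨e, s4⟩, ⟨e', se'⟩, hs⟩ :=
    exists_cyclic_perm ({g : G // g ≠ 1} × Bool ⊕ T)
  let C : CayleySystem G :=
    { Dart := RigidDart T
      next := s
      rev := RigidDart.rev
      label := RigidDart.label ⟨t₀, ht₀⟩
      sign := sgn
      nonempty := ⟨.inl 0⟩
      rev_rev := RigidDart.rev_rev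
      label_rev := RigidDart.label_rev hT _
      closure_label := by
        refine (Subgroup.eq_top_iff' _).2 fun g => ?_
        by_cases hg : g = 1
        · rw [hg]
          exact one_mem _
        · exact Subgroup.subset_closure ⟨.inr (.inl (⟨g, hg⟩, true)), rfl⟩
      next_transitive := hs }
  refine ⟨C, inferInstanceAs (Finite (RigidDart T)), rfl, ?_, ?_, ?_⟩
  · rintro (a | ⟨g, b⟩ | t) h
    · have : a = 3 := by
        have h1 : ![1, 0, 4, 3, 2] a = a := Sum.inl_injective h
        revert h1
        fin_cases a <;> decide
      subst this
      exact ht₀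
    · have h1 : (!b) = b := (Prod.mk.inj (Sum.inl_injective (Sum.inr_injective h))).2
      cases b <;> simp at h1
    · exact t.2
  · exact fun t ht => ⟨.inr (.inr ⟨t, ht⟩), rfl, rfl⟩
  · intro σ
    have hσ : ∀ i (φ : C.MapFlag), σ.1 (C.flip i φ) = C.flip i (σ.1 φ) := fun i φ => aut_r σ i φ
    obtain ⟨⟨h, d, ε⟩, hd⟩ : ∃ φ : C.MapFlag, φ = σ.1 ((1, .inl 0, 1) : C.MapFlag) := ⟨_, rfl⟩
    have hone : ∀ a : Fin 5, a ≠ 3 → C.label (.inl a) = 1 := fun a ha => RigidDart.label_inl _ ha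
    have hloop : ∀ (a b : Fin 5) (g : G) (ε : ℤˣ), a ≠ 3 → ![1, 0, 4, 3, 2] a = b →
        C.flip 0 (g, .inl a, ε) = (g, .inl b, -ε) := by
      rintro a _ g ε ha rfl
      rw [C.flip_zero, hone a ha, mul_one, map_one, one_mul]
      rfl
    have hnext : ∀ (a b : RigidDart T) (g : G), s a = b → C.flip 1 (g, a, 1) = (g, b, -1) := by
      rintro a _ g rfl
      exact C.flip_one_pos g a
    have hprev : ∀ (a b : RigidDart T) (g : G), s a = b → C.flip 1 (g, b, -1) = (g, a, 1) := by
      rintro a _ g rfl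
      rw [C.flip_one_neg]
      exact congrArg (g, ·, 1) (Equiv.symm_apply_apply s a)
    have hneg : ∀ (a : RigidDart T) (g : G), C.flip 2 (g, a, 1) = (g, a, -1) := fun _ _ => rfl
    have hpos : ∀ (a : RigidDart T) (g : G), C.flip 2 (g, a, -1) = (g, a, 1) := fun _ _ => by
      rw [C.flip_two, neg_neg]
    -- Darts `0` and `1` are consecutive and form a loop, so the marked flag lies in a monogon, and
    -- so does its image. Dart `3`, whose label is not `1`, separates `2` from `4`, so that the
    -- other loop bounds no monogon.
    have hmono : C.flip 0 (h, d, ε) = C.flip 1 (h, d, ε) := by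
      rw [hd, ← hσ, ← hσ, hloop 0 1 _ _ (by decide) rfl, hnext _ _ _ s0]
    have hlab : C.label d = 1 := by
      have := congrArg Prod.fst hmono
      rw [C.flip_zero, C.flip_one] at this
      exact mul_eq_left.1 this
    obtain ⟨a, ha, rfl⟩ := RigidDart.label_eq_one hT hlab
    have hcases : (a = 0 ∧ ε = 1) ∨ (a = 1 ∧ ε = -1) := by
      rw [hloop a _ _ _ ha rfl] at hmono
      obtain rfl | rfl := Int.units_eq_one_or ε
      · left
        refine ⟨?_, rfl⟩
        rw [C.flip_one_pos] at hmono
        have h1 : Sum.inl (![1, 0, 4, 3, 2] a) = s (.inl a) :=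
          congrArg (fun φ : C.MapFlag => φ.2.1) hmono
        fin_cases a
        · rfl
        · exact absurd (h1.trans s1) (by simp)
        · exact absurd (h1.trans s2) (by simp)
        · exact absurd rfl ha
        · exact absurd (h1.trans s4) (by simp)
      · right
        refine ⟨?_, rfl⟩
        rw [C.flip_one_neg] at hmono
        have h1 : Sum.inl (![1, 0, 4, 3, 2] a) = s.symm (.inl a) :=
          congrArg (fun φ : C.MapFlag => φ.2.1) hmono
        rw [Equiv.eq_symm_apply] at h1
        fin_cases a
        · exact absurd (h1.symm.trans s1) (by simp)
        · rfl
        · exact absurd (h1.symm.trans s4) (by simp)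
        · exact absurd rfl ha
        · exact absurd (h1.symm.trans s2) (by simp)
    obtain ⟨rfl, rfl⟩ | ⟨rfl, rfl⟩ := hcases
    · refine ⟨h, aut_ext (φ := ((1, .inl 0, 1) : C.MapFlag)) ?_⟩
      rw [← hd, C.leftMul_apply, mul_one]
    · exfalso
      -- What remains is the monogon's other flag. Going forwards from the marked flag, the loop on
      -- darts `2` and `4` gives a relation. From the other flag the same word runs backwards and
      -- crosses the dart `e'` preceding `0`, whose label would then have to be `1`.
      have h1 : C.flip 0 (C.flip 2 (C.flip 1 (C.flip 2 (C.flip 1 (1, .inl 0, 1))))) =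
          C.flip 1 (C.flip 2 (C.flip 1 (C.flip 2 (C.flip 1 (C.flip 2 (C.flip 1
            (1, .inl 0, 1))))))) := by
        rw [hnext _ _ _ s0, hpos, hnext _ _ _ s1, hpos, hnext _ _ _ s2, hpos, hnext _ _ _ s3,
          hloop 2 4 _ _ (by decide) rfl]
      have h2 := congrArg σ.1 h1
      simp only [hσ, ← hd] at h2
      have h3 := congrArg Prod.fst h2
      rw [hprev _ _ _ s0, hneg, hprev _ _ _ se', hneg, C.flip_zero] at h3
      obtain ⟨b, -, hb⟩ := RigidDart.label_eq_one hT (mul_eq_left.1 h3)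
      exact Sum.inr_ne_inl hb

theorem exists_vertexTransitive_map [Finite G] (hT : ∀ t ∈ T, orderOf t = 2)
    (hsgn : ∀ t ∈ T, sgn t = -1) (hconj : ∀ t ∈ T, ∀ g, g * t * g⁻¹ ∈ T) (hne : T.Nonempty) :
    ∃ M : SurfaceMap,
      IsClosedSurface M.Surface ∧ M.Orientable ∧ M.NoFreeEdges ∧ M.VertexTransitive ∧
      ∃ θ : G ≃* M.Aut, ∀ g : G, SurfaceMap.IsReflection (θ g) ↔ g ∈ T := by
  obtain ⟨C, hfin, rfl, h1, h2, h3⟩ := exists_rigid_cayleySystem sgn T hT hne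
  have := C.finite_flag
  refine ⟨C.toMap, isClosedSurface C.orientation_r, ⟨C.orientation, fun i φ _ =>
    C.orientation_r i φ⟩, C.noFreeEdges fun d hd h => ?_, C.vertexTransitive,
    MulEquiv.ofBijective C.leftMul ⟨C.leftMul_injective, h3⟩, fun g => ?_⟩
  · have := hT _ (h1 d hd)
    rw [h, orderOf_one] at this
    omega
  · refine (C.isReflection_leftMul_iff g).trans ⟨?_, fun hg => ?_⟩
    · rintro ⟨h, d, hd, -, rfl⟩
      exact hconj _ (h1 d hd) h
    · obtain ⟨d, hd, rfl⟩ := h2 g hg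
      exact ⟨1, d, hd, hsgn _ hg, by simp⟩

end Rigid

/-! ### The orientation character and the final assembly. -/

theorem Subgroup.exists_sign_of_index_two {G : Type*} [Group G] {H : Subgroup G}
    (h : H.index = 2) : ∃ f : G →* ℤˣ, ∀ g, g ∉ H → f g = -1 := by
  classical
  refine ⟨MonoidHom.mk' (fun g => if g ∈ H then 1 else -1) fun a b => ?_, fun g hg => if_neg hg⟩
  have := Subgroup.mul_mem_iff_of_index_two h (a := a) (b := b)
  by_cases ha : a ∈ H <;> by_cases hb : b ∈ H <;> simp [this, ha, hb]

theorem theorem1p1 {G : Type*} [Group G] [Finite G] (Gplus : Subgroup G) (hindex : Gplus.index = 2)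
    (k : ℕ) (hk : 1 ≤ k) (K : Fin k → ConjClasses G) (hdistinct : Function.Injective K)
    (hinv : ∀ i, ∀ g ∈ (K i).carrier, orderOf g = 2 ∧ g ∉ Gplus) :
    ∃ M : SurfaceMap,
      IsClosedSurface M.Surface ∧ M.Orientable ∧ M.NoFreeEdges ∧ M.VertexTransitive ∧
      ∃ θ : G ≃* M.Aut, ∀ g : G,
        SurfaceMap.IsReflection (θ g) ↔ ∃ i, g ∈ (K i).carrier := by
  obtain ⟨f, hf⟩ := Subgroup.exists_sign_of_index_two hindex
  -- Flags live in `Type`, so the finite group is replaced by an isomorphic copy there.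
  let e : Shrink.{0} G ≃* G := Shrink.mulEquiv
  have hfin : Finite (Shrink.{0} G) := Finite.of_equiv G e.symm.toEquiv
  let T : Set (Shrink.{0} G) := {t | ∃ i, e t ∈ (K i).carrier}
  have hT : ∀ t ∈ T, orderOf t = 2 := by
    rintro t ⟨i, hi⟩
    rw [← MulEquiv.orderOf_eq e t]
    exact (hinv i _ hi).1
  have hsgn : ∀ t ∈ T, f.comp e.toMonoidHom t = -1 := by
    rintro t ⟨i, hi⟩
    exact hf _ (hinv i _ hi).2
  have hconj : ∀ t ∈ T, ∀ g, g * t * g⁻¹ ∈ T := by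
    rintro t ⟨i, hi⟩ g
    refine ⟨i, ?_⟩
    rw [ConjClasses.mem_carrier_iff_mk_eq] at hi ⊢
    rw [← hi, map_mul, map_mul, map_inv]
    exact ConjClasses.mk_eq_mk_iff_isConj.2 (isConj_iff.2 ⟨e g, rfl⟩).symm
  have hne : T.Nonempty := by
    obtain ⟨g, hg⟩ := ConjClasses.exists_rep (K ⟨0, hk⟩)
    exact ⟨e.symm g, ⟨0, hk⟩, by
      rw [MulEquiv.apply_symm_apply, ConjClasses.mem_carrier_iff_mk_eq, hg]⟩
  obtain ⟨M, h1, h2, h3, h4, θ, hθ⟩ := exists_vertexTransitive_map _ T hT hsgn hconj hne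
  refine ⟨M, h1, h2, h3, h4, e.symm.trans θ, fun g => (hθ (e.symm g)).trans ?_⟩
  simp only [T, Set.mem_ofPred_eq, MulEquiv.apply_symm_apply]
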